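/- Let $d,t,\ell\ge 0$ be integers, and let $\Gamma$ be the set of all Young diagrams with $t$ boxes and at most $d$ rows. For $\gamma\in\Gamma$ let $\Pi_\gamma$ be the irreducible representation of the unitary group $\mathrm U(d)$ labelled by $\gamma$, i.e. the image of the Young symmetrizer of $\gamma$ on the $t$-fold tensor power of $\mathbb C^d$; up to isomorphism these are exactly the irreducible representations occurring in $(\mathbb C^d)^{\otimes t}$. Let $G_1,\dots,G_\ell$ be finite subgroups of $\mathrm U(d)$ such that 1. for each $\gamma\in\Gamma$ there is a $j\in\{1,\dots,\ell\}$ such that the restriction $\Pi_\gamma|_{G_j}$ is irreducible; 2. for any two distinct $\gamma,\eta\in\Gamma$ there is a $j\in\{1,\dots,\ell\}$ such that the only intertwiner between $\Pi_\gamma|_{G_j}$ and $\Pi_\eta|_{G_j}$ is $0$. Then the product set $\mathcal V = G_1\cdot\ldots\cdot G_\ell=\{h_1\cdots h_\ell : h_j\in G_j\}$ is a generalized group $t$-design. That is, with the weights $$w(V)=\frac{\bigl|\{(h_1,\dots,h_\ell)\in G_1\times\dots\times G_\ell : h_1h_2\cdots h_\ell=V\}\bigr|}{|G_1|\cdots|G_\ell|}\in[0,1],\qquad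 V\in\mathcal V,$$ one has, for every linear operator $M$ on $(\mathbb C^d)^{\otimes t}$, $$\sum_{V\in\mathcal V} w(V)\,V^{\otimes t}M\,(V^{\otimes t})^\dagger=\int_{\mathrm U(d)}U^{\otimes t}M\,(U^{\otimes t})^\dagger\,\mathrm dU,$$ where $\mathrm dU$ is the normalized Haar measure on $\mathrm U(d)$. -/

import Mathlib

open scoped TensorProduct

noncomputable section

namespace UnitaryDesign

/-- The unitary group `U(d)`, as `d × d` complex unitary matrices. -/
abbrev U (d : ℕ) := Matrix.unitaryGroup (Fin d) ℂ

/-! ### Haar measure on the (compact) unitary group -/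

instance instCompactSpace (d : ℕ) : CompactSpace (U d) := by
  have hK : IsCompact {A : Matrix (Fin d) (Fin d) ℂ | ∀ i j, A i j ∈ Metric.closedBall (0 : ℂ) 1} := by
    have h := isCompact_univ_pi (fun _ : Fin d =>
      isCompact_univ_pi (fun _ : Fin d => isCompact_closedBall (0 : ℂ) 1))
    refine h.of_isClosed_subset ?_ ?_
    · simp only [Set.ofPred_forall]
      exact isClosed_iInter fun i => isClosed_iInter fun j =>
        Metric.isClosed_closedBall.preimage (continuous_id.matrix_elem i j)
    · intro A hA i _ j _
      exact hA i j
  have hc : IsClosed ((Matrix.unitaryGroup (Fin d) ℂ : Set (Matrix (Fin d) (Fin d) ℂ))) := by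
    have he : (Matrix.unitaryGroup (Fin d) ℂ : Set (Matrix (Fin d) (Fin d) ℂ)) =
        {A | A * star A = 1} := by
      ext A
      exact Matrix.mem_unitaryGroup_iff
    rw [he]
    exact isClosed_eq (continuous_id.mul continuous_star) continuous_const
  refine isCompact_iff_compactSpace.mp (hK.of_isClosed_subset hc ?_)
  intro A hA i j
  simpa using entry_norm_bound_of_unitary hA i j

/-- `U(d)` carries its Borel σ-algebra. -/
instance instMeasurableSpace (d : ℕ) : MeasurableSpace (U d) := borel _

instance instBorelSpace (d : ℕ) : BorelSpace (U d) := ⟨rfl⟩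

/-- The Haar measure on `U(d)`, normalised to total mass `1`. -/
def haar (d : ℕ) : MeasureTheory.Measure (U d) := MeasureTheory.Measure.haarMeasure ⊤

instance instIsHaarMeasure (d : ℕ) : (haar d).IsHaarMeasure := by
  unfold haar; infer_instance

instance instIsProbabilityMeasure (d : ℕ) : MeasureTheory.IsProbabilityMeasure (haar d) :=
  ⟨by simpa [haar] using MeasureTheory.Measure.haarMeasure_self (G := U d) (K₀ := ⊤)⟩

/-! ### Tensor powers of the defining representation -/

/-- The tensor power `(ℂ^d)^{⊗ι}` with tensor factors indexed by `ι`; the `t`-fold tensor power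
is the case `ι = Fin t`. -/
abbrev TensorPow (d : ℕ) (ι : Type) := ⨂[ℂ] _ : ι, (Fin d → ℂ)

/-- The operator `A^{⊗ι}` on `(ℂ^d)^{⊗ι}`, for a `d × d` matrix `A`. -/
def tensorPowOp {d : ℕ} (ι : Type) (A : Matrix (Fin d) (Fin d) ℂ) :
    Module.End ℂ (TensorPow d ι) :=
  PiTensorProduct.map fun _ => Matrix.toLin' A

/-- The tensor power `U ↦ U^{⊗ι}` of the defining representation of `U(d)`. -/
def tensorPowRep (d : ℕ) (ι : Type) : Representation ℂ (U d) (TensorPow d ι) where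
  toFun V := tensorPowOp ι V.1
  map_one' := by simp [tensorPowOp, Module.End.one_eq_id]
  map_mul' V W := by
    simp only [tensorPowOp, Submonoid.coe_mul, Matrix.toLin'_mul]
    exact PiTensorProduct.map_mul _ _

/-! ### The irreducible representation of `U(d)` labelled by a Young diagram -/

/-- The action of a permutation of the tensor factors on `(ℂ^d)^{⊗ι}`. -/
def permOp (d : ℕ) {ι : Type} (σ : Equiv.Perm ι) : Module.End ℂ (TensorPow d ι) :=
  (PiTensorProduct.reindex ℂ (fun _ : ι => (Fin d → ℂ)) σ).toLinearMap

/-- The permutations of the boxes of `γ` that preserve every row. -/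
def rowPerms (γ : YoungDiagram) : Finset (Equiv.Perm γ.cells) :=
  Finset.univ.filter fun σ => ∀ c : γ.cells, (σ c).1.1 = c.1.1

/-- The permutations of the boxes of `γ` that preserve every column. -/
def colPerms (γ : YoungDiagram) : Finset (Equiv.Perm γ.cells) :=
  Finset.univ.filter fun σ => ∀ c : γ.cells, (σ c).1.2 = c.1.2

/-- The Young symmetrizer of `γ` acting on the tensor power whose factors are indexed by the boxes
of `γ`: symmetrize along the rows, then antisymmetrize along the columns. -/
def youngSymmetrizer (d : ℕ) (γ : YoungDiagram) : Module.End ℂ (TensorPow d γ.cells) :=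
  (∑ σ ∈ colPerms γ, ((Equiv.Perm.sign σ : ℤ) : ℂ) • permOp d σ) * ∑ σ ∈ rowPerms γ, permOp d σ

theorem permOp_comm {d : ℕ} {ι : Type} (σ : Equiv.Perm ι) (A : Matrix (Fin d) (Fin d) ℂ) :
    Commute (permOp d σ) (tensorPowOp ι A) := by
  refine PiTensorProduct.ext (MultilinearMap.ext fun v => ?_)
  have h (u : ι → Fin d → ℂ) : permOp d σ (PiTensorProduct.tprod ℂ u) =
      PiTensorProduct.tprod ℂ fun i => u (σ.symm i) := PiTensorProduct.reindex_tprod σ u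
  have k (u : ι → Fin d → ℂ) : tensorPowOp ι A (PiTensorProduct.tprod ℂ u) =
      PiTensorProduct.tprod ℂ fun i => Matrix.toLin' A (u i) := PiTensorProduct.map_tprod _ _
  simp only [LinearMap.compMultilinearMap_apply, Module.End.mul_apply, h, k]

theorem youngSymmetrizer_comm {d : ℕ} (γ : YoungDiagram) (A : Matrix (Fin d) (Fin d) ℂ) :
    Commute (youngSymmetrizer d γ) (tensorPowOp γ.cells A) :=
  Commute.mul_left
    (Commute.sum_left _ _ _ fun σ _ => (permOp_comm σ A).smul_left _)
    (Commute.sum_left _ _ _ fun σ _ => permOp_comm σ A)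

/-- The image of the Young symmetrizer of `γ`. -/
def weylSpace (d : ℕ) (γ : YoungDiagram) : Submodule ℂ (TensorPow d γ.cells) :=
  LinearMap.range (youngSymmetrizer d γ)

theorem tensorPowRep_mem_weylSpace {d : ℕ} (γ : YoungDiagram) (V : U d)
    ⦃x : TensorPow d γ.cells⦄ (hx : x ∈ weylSpace d γ) :
    tensorPowRep d γ.cells V x ∈ weylSpace d γ := by
  obtain ⟨y, rfl⟩ := hx
  exact ⟨tensorPowOp γ.cells V.1 y, LinearMap.congr_fun (youngSymmetrizer_comm γ V.1) y⟩

/-- The representation `Π_γ` of `U(d)` labelled by the Young diagram `γ`: the image of the Young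
symmetrizer of `γ` (Weyl's construction), as a subrepresentation of the tensor power. -/
def weylRep (d : ℕ) (γ : YoungDiagram) : Representation ℂ (U d) (weylSpace d γ) :=
  Subrepresentation.toRepresentation (ρ := tensorPowRep d γ.cells)
    ⟨weylSpace d γ, tensorPowRep_mem_weylSpace γ⟩

/-- `Π_γ|_G`, the restriction of `Π_γ` to a subgroup `G` of `U(d)`. -/
def weylRepRes {d : ℕ} (γ : YoungDiagram) (G : Subgroup (U d)) :
    Representation ℂ G (weylSpace d γ) :=
  (weylRep d γ).comp G.subtype

/-- The Young diagrams with `t` boxes and at most `d` rows. -/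
def diagrams (t d : ℕ) : Set YoungDiagram := {γ | γ.card = t ∧ γ.colLen 0 ≤ d}

/-! ### Unitary designs -/

/-- `V^{⊗t} M (V^{⊗t})†`. -/
def conjOp {d : ℕ} (t : ℕ) (M : Module.End ℂ (TensorPow d (Fin t))) (V : U d) :
    Module.End ℂ (TensorPow d (Fin t)) :=
  tensorPowOp (Fin t) V.1 * M * tensorPowOp (Fin t) (star V.1)

/-- A finite set `𝒱 ⊆ U(d)` with weight function `w : 𝒱 → [0, 1]` is a unitary `t`-design if
`∑_{V ∈ 𝒱} w(V) V^{⊗t} M (V^{⊗t})† = ∫ U^{⊗t} M (U^{⊗t})† dU` for all operators `M` on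
`(ℂ^d)^{⊗t}`. The integral is taken in the finite-dimensional space of operators on
`(ℂ^d)^{⊗t}`, that is, the equation is tested against all linear functionals on that space. -/
structure IsUnitaryDesign {d : ℕ} (t : ℕ) (𝒱 : Finset (U d)) (w : U d → ℝ) : Prop where
  weight_mem : ∀ V ∈ 𝒱, w V ∈ Set.Icc (0 : ℝ) 1
  twirl_eq : ∀ (M : Module.End ℂ (TensorPow d (Fin t)))
    (f : Module.Dual ℂ (Module.End ℂ (TensorPow d (Fin t)))),
    f (∑ V ∈ 𝒱, (w V : ℂ) • conjOp t M V) = ∫ V : U d, f (conjOp t M V) ∂(haar d)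

section Products

variable {d ℓ : ℕ} (G : Fin ℓ → Subgroup (U d))

/-- The ordered product `h_1 ⋯ h_ℓ` of a tuple with `h_j ∈ G_j`. -/
def tupleProd (h : ∀ j, G j) : U d := (List.ofFn fun j => (h j : U d)).prod

/-- The product set `G_1 ⋯ G_ℓ` of finite subgroups. -/
def productSet [∀ j, Finite (G j)] : Finset (U d) := (Set.finite_range (tupleProd G)).toFinset

/-- The weight of `V`: the proportion of tuples in `G_1 × ⋯ × G_ℓ` whose product is `V`. -/
def productWeight (V : U d) : ℝ :=
  (Nat.card {h : ∀ j, G j // tupleProd G h = V} : ℝ) / ∏ j, (Nat.card (G j) : ℝ)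

/-- The product `G_1 ⋯ G_ℓ` of finite subgroups of `U(d)` is a generalized group `t`-design. -/
def IsGeneralizedGroupDesign (t : ℕ) [∀ j, Finite (G j)] : Prop :=
  IsUnitaryDesign t (productSet G) (productWeight G)

end Products

end UnitaryDesign

end

/-! Let `S` be the sum of the conjugates of `M` over all tuples. If `S` commutes with every
`V^{⊗t}`, then Haar averaging leaves `S` alone, while right invariance turns the Haar average of
each summand into that of `M`; dividing by the number of tuples gives the design identity
(`card_mul_integral_conjOp`).

That `S` commutes is checked blockwise. By `one_mem_span_comp_weylSpace` the identity of the tensor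
power is a combination of `φ ∘ ψ`, with intertwiners passing through some `Π_γ`, so it suffices that
each `ψ ∘ S ∘ φ : Π_γ → Π_η` is an intertwiner. This block is an ordered product of subgroup sums
acting on `Hom(Π_γ, Π_η)`. One factor lands in the `U(d)`-invariants: by Schur's lemma if `γ = η`,
by the absence of intertwiners otherwise. The other factors preserve the invariants, so
noncommutativity of the product does no harm.

The decomposition comes from the group algebra of the symmetric group. Young symmetrizers of
distinct diagrams generate orthogonal nonzero ideals, and there are as many as conjugacy classes, so
their central idempotents sum to 1. Irreducibility of `Π_γ` under `U(d)` need not be known in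
advance. -/

open scoped TensorProduct

noncomputable section

/-! ### Central idempotents and class functions -/

/-- In a semisimple ring, every two-sided ideal is generated by a central idempotent. -/
theorem IsSemisimpleRing.exists_central_idempotent {R : Type*} [Ring R] [IsSemisimpleRing R]
    (I : Ideal R) [I.IsTwoSided] :
    ∃ e ∈ I, IsIdempotentElem e ∧ (∀ x, e * x = x * e) ∧ I = Ideal.span {e} := by
  obtain ⟨e, he, hI⟩ := IsSemisimpleRing.ideal_eq_span_idempotent I
  have heI : e ∈ I := hI ▸ Ideal.subset_span rfl
  have hright (x : R) : e * x * e = e * x := by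
    have hx : e * x ∈ I := I.mul_mem_right x heI
    rw [hI, Ideal.mem_span_singleton'] at hx
    obtain ⟨y, hy⟩ := hx
    rw [← hy, mul_assoc, he.eq]
  refine ⟨e, heI, he, fun x => ?_, hI⟩
  -- `z` measures the failure of `x * e = e * x * e`. Since `z * a * z = 0` for all `a`, an
  -- idempotent generating the left ideal of `z` squares to zero, which forces `z = 0`.
  set z := x * e - e * x * e with hz
  have hez (a : R) : e * a * z = 0 := by
    have h1 : e * (a * x) * e = e * (a * x) := hright _
    have h2 : e * a * e = e * a := hright a
    have h3 : e * a * z = e * (a * x) * e - e * a * e * x * e := by rw [hz]; noncomm_ring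
    rw [h3, h2, mul_assoc e a x, sub_self]
  have hzaz (a : R) : z * a * z = 0 := by
    have h3 : z * a * z = x * (e * a * z) - e * x * (e * a * z) := by rw [hz]; noncomm_ring
    rw [h3, hez]; simp
  obtain ⟨f, hf, hJ⟩ := IsSemisimpleRing.ideal_eq_span_idempotent (Ideal.span {z})
  have hfz : f ∈ Ideal.span {z} := hJ ▸ Ideal.subset_span rfl
  obtain ⟨a, ha⟩ := Ideal.mem_span_singleton'.1 hfz
  have hf0 : f = 0 := by
    rw [← hf.eq, ← ha]
    calc a * z * (a * z) = a * (z * a * z) := by noncomm_ring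
      _ = 0 := by rw [hzaz, mul_zero]
  have hz0 : z = 0 := by
    have : z ∈ Ideal.span {f} := hJ ▸ Ideal.subset_span rfl
    simpa [hf0] using this
  have h := hright x
  rw [sub_eq_zero.1 (hz.symm.trans hz0), h]

theorem linearIndependent_of_orthogonal_idempotents {k R ι : Type*} [Field k] [Ring R]
    [Algebra k R] (e : ι → R) (hid : ∀ i, e i * e i = e i) (hne : ∀ i, e i ≠ 0)
    (horth : ∀ i j, i ≠ j → e i * e j = 0) : LinearIndependent k e := by
  classical
  rw [linearIndependent_iff']
  intro s c hc i hi
  have h := congrArg (· * e i) hc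
  simp only [Finset.sum_mul, zero_mul, smul_mul_assoc] at h
  rw [Finset.sum_eq_single i (fun j _ hj => by rw [horth j i hj, smul_zero])
    (fun h => absurd hi h), hid] at h
  exact (smul_eq_zero.1 h).resolve_right (hne i)

/-- Central elements of the group algebra of a symmetric group span a space of dimension at most
the number of partitions. -/
theorem MonoidAlgebra.card_le_of_linearIndependent_central {α ι : Type*} [Fintype α]
    [DecidableEq α] [Fintype ι] (e : ι → MonoidAlgebra ℂ (Equiv.Perm α))
    (hc : ∀ i x, e i * x = x * e i) (he : LinearIndependent ℂ e) :
    Fintype.card ι ≤ Fintype.card (Nat.Partition (Fintype.card α)) := by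
  classical
  -- One permutation per cycle type; the default `1` is never consulted below, where `rep` is only
  -- evaluated at cycle types that occur.
  let rep : Nat.Partition (Fintype.card α) → Equiv.Perm α := fun p =>
    if h : ∃ σ : Equiv.Perm α, σ.partition = p then h.choose else 1
  let Φ : MonoidAlgebra ℂ (Equiv.Perm α) →ₗ[ℂ] (Nat.Partition (Fintype.card α) → ℂ) :=
    { toFun := fun x p => x.coeff (rep p)
      map_add' := fun x y => rfl
      map_smul' := fun c x => rfl }
  have hspan : ∀ x ∈ Submodule.span ℂ (Set.range e), ∀ y, x * y = y * x := by
    intro x hx y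
    induction hx using Submodule.span_induction with
    | mem x h => obtain ⟨i, rfl⟩ := h; exact hc i y
    | zero => simp
    | add a b _ _ ha hb => rw [add_mul, mul_add, ha, hb]
    | smul c a _ ha => rw [smul_mul_assoc, mul_smul_comm, ha]
  -- Commuting with each `τ` makes the coefficients constant on conjugacy classes, so a central
  -- element is determined by its values on the representatives.
  have hinj : ∀ x ∈ Submodule.span ℂ (Set.range e), Φ x = 0 → x = 0 := by
    intro x hx h0
    rw [← MonoidAlgebra.coeff_inj]
    ext σ
    have hex : ∃ τ : Equiv.Perm α, τ.partition = σ.partition := ⟨σ, rfl⟩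
    have hr : (rep σ.partition).partition = σ.partition := by
      simp only [rep, dif_pos hex]; exact hex.choose_spec
    obtain ⟨τ, hτ⟩ := isConj_iff.1 (Equiv.Perm.partition_eq_of_isConj.2 hr)
    have h1 := congrArg (fun y : MonoidAlgebra ℂ (Equiv.Perm α) => y.coeff (τ * rep σ.partition))
      (hspan x hx (MonoidAlgebra.single τ 1))
    simp only [MonoidAlgebra.coeff_mul_single_apply, MonoidAlgebra.coeff_single_mul_apply, hτ,
      inv_mul_cancel_left, mul_one, one_mul] at h1
    have h2 : x.coeff (rep σ.partition) = 0 := congrFun h0 σ.partition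
    rw [h1, h2]; rfl
  have hli : LinearIndependent ℂ (Φ ∘ e) := by
    refine he.map ?_
    rw [Submodule.disjoint_def]
    intro x hx hk
    exact hinj x hx hk
  simpa using hli.fintype_card_le_finrank

namespace UnitaryDesign

/-! ### Young symmetrizers in the group algebra -/

section GroupAlgebra

variable {α : Type} [Fintype α] [DecidableEq α]

/-- The permutations preserving the function `f`. -/
def fiberPerms (f : α → ℕ) : Finset (Equiv.Perm α) :=
  Finset.univ.filter fun σ => ∀ x, f (σ x) = f x

theorem mem_fiberPerms {f : α → ℕ} {σ : Equiv.Perm α} :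
    σ ∈ fiberPerms f ↔ ∀ x, f (σ x) = f x := by simp [fiberPerms]

theorem mul_mem_fiberPerms {f : α → ℕ} {σ τ : Equiv.Perm α} (hσ : σ ∈ fiberPerms f)
    (hτ : τ ∈ fiberPerms f) : σ * τ ∈ fiberPerms f := by
  rw [mem_fiberPerms] at *
  intro x
  rw [Equiv.Perm.mul_apply, hσ, hτ]

theorem swap_mem_fiberPerms {f : α → ℕ} {i j : α} (h : f i = f j) :
    Equiv.swap i j ∈ fiberPerms f := by
  rw [mem_fiberPerms]
  intro x
  rw [Equiv.swap_apply_def]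
  split_ifs with h1 h2
  · rw [h1, h]
  · rw [h2, h]
  · rfl

/-- The sum, in the group algebra, of the permutations preserving `f`. -/
def fiberSymm (f : α → ℕ) : MonoidAlgebra ℂ (Equiv.Perm α) :=
  ∑ σ ∈ fiberPerms f, MonoidAlgebra.of ℂ _ σ

/-- The signed sum, in the group algebra, of the permutations preserving `f`. -/
def fiberAntisymm (f : α → ℕ) : MonoidAlgebra ℂ (Equiv.Perm α) :=
  ∑ σ ∈ fiberPerms f, ((Equiv.Perm.sign σ : ℤ) : ℂ) • MonoidAlgebra.of ℂ _ σ

/-- The Young symmetrizer, in the group algebra, of a filling whose entry `x` lies in row `f x`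
and in column `g x`. -/
def youngElement (f g : α → ℕ) : MonoidAlgebra ℂ (Equiv.Perm α) :=
  fiberAntisymm g * fiberSymm f

theorem fiberSymm_mul_swap {f : α → ℕ} {i j : α} (h : f i = f j) :
    fiberSymm f * MonoidAlgebra.of ℂ _ (Equiv.swap i j) = fiberSymm f := by
  rw [fiberSymm, Finset.sum_mul]
  refine Finset.sum_nbij' (· * Equiv.swap i j) (· * Equiv.swap i j) ?_ ?_ ?_ ?_ ?_
  · exact fun σ hσ => mul_mem_fiberPerms hσ (swap_mem_fiberPerms h)
  · exact fun σ hσ => mul_mem_fiberPerms hσ (swap_mem_fiberPerms h)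
  · intro σ _; simp [mul_assoc]
  · intro σ _; simp [mul_assoc]
  · intro σ _; rw [map_mul]

theorem swap_mul_fiberAntisymm {f : α → ℕ} {i j : α} (hij : i ≠ j) (h : f i = f j) :
    MonoidAlgebra.of ℂ _ (Equiv.swap i j) * fiberAntisymm f = -fiberAntisymm f := by
  rw [fiberAntisymm, Finset.mul_sum, ← Finset.sum_neg_distrib]
  refine Finset.sum_nbij' (Equiv.swap i j * ·) (Equiv.swap i j * ·) ?_ ?_ ?_ ?_ ?_
  · exact fun σ hσ => mul_mem_fiberPerms (swap_mem_fiberPerms h) hσ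
  · exact fun σ hσ => mul_mem_fiberPerms (swap_mem_fiberPerms h) hσ
  · intro σ _; simp [← mul_assoc]
  · intro σ _; simp [← mul_assoc]
  · intro σ _
    rw [mul_smul_comm, ← map_mul, ← neg_smul]
    simp [Equiv.Perm.sign_swap hij]

/-- Moving the swap of `i, j` leftwards through `σ` yields the swap of `σ i, σ j`, which the
symmetrizer absorbs; moved rightwards it changes the sign of the antisymmetrizer. The product thus
equals its own negative. -/
theorem fiberSymm_mul_of_mul_fiberAntisymm {f g : α → ℕ} {σ : Equiv.Perm α} {i j : α}
    (hij : i ≠ j) (hg : g i = g j) (hf : f (σ i) = f (σ j)) :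
    fiberSymm f * MonoidAlgebra.of ℂ _ σ * fiberAntisymm g = 0 := by
  have h1 : fiberSymm f * MonoidAlgebra.of ℂ _ σ * MonoidAlgebra.of ℂ _ (Equiv.swap i j) =
      fiberSymm f * MonoidAlgebra.of ℂ _ σ := by
    conv_rhs => rw [← fiberSymm_mul_swap hf]
    rw [mul_assoc, mul_assoc, ← map_mul, ← map_mul, Equiv.swap_apply_apply]
    simp [mul_assoc]
  have h2 : fiberSymm f * MonoidAlgebra.of ℂ _ σ * fiberAntisymm g =
      -(fiberSymm f * MonoidAlgebra.of ℂ _ σ * fiberAntisymm g) := by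
    conv_lhs => rw [← h1]
    rw [mul_assoc, swap_mul_fiberAntisymm hij hg, mul_neg]
  have h3 := add_eq_zero_iff_eq_neg.2 h2
  rw [← two_smul ℂ] at h3
  exact (smul_eq_zero.1 h3).resolve_left two_ne_zero

theorem fiberSymm_mul_mul_fiberAntisymm_eq_zero {f g : α → ℕ}
    (h : ∀ σ : Equiv.Perm α, ∃ i j, i ≠ j ∧ g i = g j ∧ f (σ i) = f (σ j))
    (x : MonoidAlgebra ℂ (Equiv.Perm α)) : fiberSymm f * x * fiberAntisymm g = 0 := by
  induction x using MonoidAlgebra.induction_on with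
  | of σ =>
    obtain ⟨i, j, hij, hg, hf⟩ := h σ
    exact fiberSymm_mul_of_mul_fiberAntisymm hij hg hf
  | add a b ha hb => rw [mul_add, add_mul, ha, hb, add_zero]
  | smul c a ha => rw [mul_smul_comm, smul_mul_assoc, ha, smul_zero]

theorem youngElement_mul_mul_youngElement_eq_zero {f g f' g' : α → ℕ}
    (h : ∀ σ : Equiv.Perm α, ∃ i j, i ≠ j ∧ g' i = g' j ∧ f (σ i) = f (σ j))
    (x : MonoidAlgebra ℂ (Equiv.Perm α)) : youngElement f g * x * youngElement f' g' = 0 := by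
  have := fiberSymm_mul_mul_fiberAntisymm_eq_zero h x
  calc youngElement f g * x * youngElement f' g'
      = fiberAntisymm g * (fiberSymm f * x * fiberAntisymm g') * fiberSymm f' := by
        simp only [youngElement, mul_assoc]
    _ = 0 := by rw [this, mul_zero, zero_mul]

/-- The coefficient at the identity is 1: since row and column determine an entry, a column
permutation and a row permutation are mutually inverse only if both are trivial. -/
theorem youngElement_ne_zero {f g : α → ℕ} (h : ∀ x y, f x = f y → g x = g y → x = y) :
    youngElement f g ≠ 0 := by
  have key : (youngElement f g).coeff 1 = 1 := by
    have h1 : youngElement f g = ∑ q ∈ fiberPerms g, ∑ p ∈ fiberPerms f,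
        MonoidAlgebra.single (q * p) ((Equiv.Perm.sign q : ℤ) : ℂ) := by
      rw [youngElement, fiberAntisymm, fiberSymm, Finset.sum_mul_sum]
      refine Finset.sum_congr rfl fun q _ => Finset.sum_congr rfl fun p _ => ?_
      rw [smul_mul_assoc, ← map_mul, MonoidAlgebra.of_apply, MonoidAlgebra.smul_single]
      simp
    have hone (f : α → ℕ) : (1 : Equiv.Perm α) ∈ fiberPerms f := mem_fiberPerms.2 fun _ => rfl
    have h2 : ∀ q ∈ fiberPerms g, ∀ p ∈ fiberPerms f, q * p = 1 → q = 1 ∧ p = 1 := by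
      intro q hq p hp hqp
      have hp1 : p = 1 := by
        refine Equiv.ext fun x => ?_
        refine (h _ _ (mem_fiberPerms.1 hp x) ?_)
        rw [← mem_fiberPerms.1 hq (p x), ← Equiv.Perm.mul_apply, hqp]
      exact ⟨by simpa [hp1] using hqp, hp1⟩
    simp only [h1, MonoidAlgebra.coeff_sum, Finset.sum_apply', MonoidAlgebra.coeff_single,
      Finsupp.single_apply]
    rw [Finset.sum_eq_single_of_mem 1 (hone g), Finset.sum_eq_single_of_mem 1 (hone f)]
    · simp
    · intro p hp hne
      exact if_neg fun h => hne (h2 1 (hone g) p hp h).2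
    · intro q hq hne
      exact Finset.sum_eq_zero fun p hp => if_neg fun h => hne (h2 q hq p hp h).1
  intro h0
  rw [h0] at key
  exact zero_ne_one key

end GroupAlgebra

/-! ### Completeness of the Young symmetrizers -/

section GroupAlgebra

variable {α : Type} [Fintype α] [DecidableEq α]

/-- The group algebra of the symmetric group is spanned, as a two-sided ideal, by one Young
symmetrizer for each partition. -/
theorem one_mem_span_youngElement (f g : Nat.Partition (Fintype.card α) → α → ℕ)
    (hinj : ∀ p x y, f p x = f p y → g p x = g p y → x = y)
    (hne : ∀ p q, p ≠ q →
      (∀ σ : Equiv.Perm α, ∃ i j, i ≠ j ∧ g q i = g q j ∧ f p (σ i) = f p (σ j)) ∨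
      (∀ σ : Equiv.Perm α, ∃ i j, i ≠ j ∧ g p i = g p j ∧ f q (σ i) = f q (σ j))) :
    (1 : MonoidAlgebra ℂ (Equiv.Perm α)) ∈ Submodule.span ℂ
      {z | ∃ p x y, z = x * youngElement (f p) (g p) * y} := by
  classical
  set A := MonoidAlgebra ℂ (Equiv.Perm α)
  have : NeZero (Nat.card (Equiv.Perm α) : ℂ) := ⟨by exact_mod_cast Nat.card_pos.ne'⟩
  let c : Nat.Partition (Fintype.card α) → A := fun p => youngElement (f p) (g p)
  let I : Nat.Partition (Fintype.card α) → Ideal A := fun p =>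
    Ideal.span (Set.range fun y => c p * y)
  have hcI (p) : c p ∈ I p := Ideal.subset_span ⟨1, mul_one _⟩
  have hmem (p) (z : A) (hz : z ∈ I p) : z ∈ Submodule.span ℂ
      {z | ∃ x y, z = x * c p * y} := by
    induction hz using Submodule.span_induction with
    | mem z h => obtain ⟨y, rfl⟩ := h; exact Submodule.subset_span ⟨1, y, by rw [one_mul]⟩
    | zero => exact zero_mem _
    | add a b _ _ ha hb => exact add_mem ha hb
    | smul s a h0 ha =>
      clear h0
      induction ha using Submodule.span_induction with
      | mem z h =>
        obtain ⟨x, y, rfl⟩ := h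
        exact Submodule.subset_span ⟨s * x, y, by simp only [smul_eq_mul, mul_assoc]⟩
      | zero => rw [smul_zero]; exact zero_mem _
      | add a b _ _ ha hb => rw [smul_add]; exact add_mem ha hb
      | smul r a _ ha => rw [smul_comm]; exact Submodule.smul_mem _ _ ha
  have htwo (p) : (I p).IsTwoSided := by
    refine ⟨fun {a} b ha => ?_⟩
    induction ha using Submodule.span_induction with
    | mem z h =>
      obtain ⟨y, rfl⟩ := h
      exact Ideal.subset_span ⟨y * b, by simp only [mul_assoc]⟩
    | zero => rw [zero_mul]; exact zero_mem _
    | add a b _ _ ha hb => rw [add_mul]; exact add_mem ha hb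
    | smul s a _ ha => rw [smul_eq_mul, mul_assoc]; exact (I p).mul_mem_left _ ha
  choose e heI hid hcent hspan using fun p =>
    have := htwo p
    IsSemisimpleRing.exists_central_idempotent (I p)
  -- Each idempotent lies in the span of the `x * c * y`, so vanishing of all `c p * x * c q` kills
  -- the product of idempotents.
  have hmul0 (p q) (h : ∀ x, c p * x * c q = 0) : e p * e q = 0 := by
    have h1 : ∀ a ∈ Submodule.span ℂ {z | ∃ x y, z = x * c p * y},
        ∀ b ∈ Submodule.span ℂ {z | ∃ x y, z = x * c q * y}, a * b = 0 := by
      intro a ha b hb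
      induction ha using Submodule.span_induction with
      | zero => exact zero_mul _
      | add a a' _ _ ha ha' => rw [add_mul, ha, ha', add_zero]
      | smul r a _ ha => rw [smul_mul_assoc, ha, smul_zero]
      | mem z hz =>
        obtain ⟨x, y, rfl⟩ := hz
        induction hb using Submodule.span_induction with
        | zero => exact mul_zero _
        | add a a' _ _ ha ha' => rw [mul_add, ha, ha', add_zero]
        | smul r a _ ha => rw [mul_smul_comm, ha, smul_zero]
        | mem w hw =>
          obtain ⟨x', y', rfl⟩ := hw
          calc x * c p * y * (x' * c q * y') = x * (c p * (y * x') * c q) * y' := by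
                simp only [mul_assoc]
            _ = 0 := by rw [h, mul_zero, zero_mul]
    exact h1 _ (hmem p _ (heI p)) _ (hmem q _ (heI q))
  have horth (p q) (hpq : p ≠ q) : e p * e q = 0 := by
    rcases hne p q hpq with h | h
    · exact hmul0 p q (youngElement_mul_mul_youngElement_eq_zero h)
    -- The combinatorial hypothesis may hold only in the opposite order; centrality makes the order
    -- irrelevant.
    · rw [hcent p]
      exact hmul0 q p (youngElement_mul_mul_youngElement_eq_zero h)
  have hene (p) : e p ≠ 0 := by
    intro h0
    have h1 := hcI p
    rw [hspan p, h0, Ideal.mem_span_singleton'] at h1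
    obtain ⟨a, ha⟩ := h1
    exact youngElement_ne_zero (hinj p) (by rw [← mul_zero a]; exact ha.symm)
  -- Otherwise `1 - ∑ p, e p` is a further nonzero central idempotent orthogonal to all `e p`,
  -- giving one more independent central element than there are partitions.
  have hsum : ∑ p, e p = 1 := by
    by_contra hs
    have hl (q) : (∑ p, e p) * e q = e q := by
      rw [Finset.sum_mul, Finset.sum_eq_single q (fun p _ hp => horth p q hp) (by simp)]
      exact hid q
    have hcs (x) : (∑ p, e p) * x = x * ∑ p, e p := by
      rw [Finset.sum_mul, Finset.mul_sum]
      exact Finset.sum_congr rfl fun p _ => hcent p x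
    have h0 (q) : (1 - ∑ p, e p) * e q = 0 := by rw [sub_mul, hl, one_mul, sub_self]
    let e' : Option (Nat.Partition (Fintype.card α)) → A :=
      fun o => o.elim (1 - ∑ p, e p) e
    have hli : LinearIndependent ℂ e' := by
      refine linearIndependent_of_orthogonal_idempotents e' ?_ ?_ ?_
      · rintro (_ | p)
        · show (1 - ∑ p, e p) * (1 - ∑ p, e p) = 1 - ∑ p, e p
          rw [mul_sub, Finset.mul_sum, Finset.sum_eq_zero fun q _ => h0 q, mul_one, sub_zero]
        · exact hid p
      · rintro (_ | p)
        · exact fun h => hs (sub_eq_zero.1 h).symm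
        · exact hene p
      · rintro (_ | p) (_ | q) h
        · exact absurd rfl h
        · exact h0 q
        · show e p * (1 - ∑ p, e p) = 0
          rw [hcent p, h0]
        · exact horth p q fun h' => h (congrArg some h')
    have hcard := MonoidAlgebra.card_le_of_linearIndependent_central e' (by
      rintro (_ | p) x
      · show (1 - ∑ p, e p) * x = x * (1 - ∑ p, e p)
        rw [sub_mul, mul_sub, hcs, one_mul, mul_one]
      · exact hcent p x) hli
    rw [Fintype.card_option] at hcard
    omega
  rw [← hsum]
  refine sum_mem fun p _ => Submodule.span_mono ?_ (hmem p _ (heI p))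
  rintro z ⟨x, y, rfl⟩
  exact ⟨p, x, y, rfl⟩

end GroupAlgebra

end UnitaryDesign

/-! ### Dominance of Young diagrams, and diagrams of partitions -/

namespace YoungDiagram

/-- The number of cells in the first `k` rows is monotone for the existence of a bijection of cells
that maps cells of one row to cells of distinct columns. -/
theorem card_filter_fst_lt_le {μ ν : YoungDiagram} (F : μ.cells ≃ ν.cells)
    (hF : ∀ c c', c ≠ c' → c.1.1 = c'.1.1 → (F c).1.2 ≠ (F c').1.2) (k : ℕ) :
    (Finset.univ.filter fun c : μ.cells => c.1.1 < k).card ≤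
      (Finset.univ.filter fun c : ν.cells => c.1.1 < k).card := by
  classical
  rw [Finset.card_eq_sum_card_fiberwise (f := fun c : μ.cells => (F c).1.2)
      (t := ν.cells.image Prod.snd)
      (fun c _ => Finset.mem_coe.2 (Finset.mem_image_of_mem _ (F c).2)),
    Finset.card_eq_sum_card_fiberwise (f := fun c : ν.cells => c.1.2)
      (t := ν.cells.image Prod.snd)
      (fun c _ => Finset.mem_coe.2 (Finset.mem_image_of_mem _ c.2))]
  -- Compare column by column. The cells of `μ` sent to column `j` lie in distinct rows, so at most
  -- `k` of them come from the first `k` rows, and they inject into the column; `ν` has `min k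
  -- (ν.colLen j)` such cells there.
  refine Finset.sum_le_sum fun j _ => ?_
  have h1 : min k (ν.colLen j) ≤
      (({c | c.1.1 < k} : Finset ν.cells).filter fun c => c.1.2 = j).card := by
    rw [← Finset.card_range (min k (ν.colLen j)), ← Fintype.card_coe]
    refine Finset.card_le_card_of_injOn
      (fun i => ⟨(i.1, j), (mem_cells _).2 <| mem_iff_lt_colLen.2
        ((Finset.mem_range.1 i.2).trans_le (min_le_right _ _))⟩) ?_ ?_
    · intro i _
      simpa using (Finset.mem_range.1 i.2).trans_le (min_le_left _ _)
    · intro i _ i' _ h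
      exact Subtype.ext (congrArg (fun c => c.1.1) h)
  refine le_trans (le_min ?_ ?_) h1
  · conv_rhs => rw [← Finset.card_range k]
    refine Finset.card_le_card_of_injOn (fun c => c.1.1) ?_ ?_
    · intro c hc
      simp only [Finset.coe_filter, Finset.mem_filter, Finset.mem_univ, true_and,
        Set.mem_ofPred_eq] at hc
      simpa using hc.1
    · intro c hc c' hc' h
      simp only [Finset.coe_filter, Finset.mem_filter, Finset.mem_univ, true_and,
        Set.mem_ofPred_eq] at hc hc'
      by_contra hcc
      exact hF c c' hcc h (hc.2.trans hc'.2.symm)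
  · rw [colLen_eq_card]
    refine Finset.card_le_card_of_injOn (fun c => (F c).1) ?_ ?_
    · intro c hc
      simp only [Finset.coe_filter, Finset.mem_filter, Finset.mem_univ, true_and,
        Set.mem_ofPred_eq] at hc
      exact Finset.mem_coe.2 (mem_col_iff.2 ⟨(F c).2, hc.2⟩)
    · intro c _ c' _ h
      exact F.injective (Subtype.ext h)

/-- Successive counts differ by one row length, and the row lengths determine the diagram. -/
theorem eq_of_card_filter_fst_lt {μ ν : YoungDiagram}
    (h : ∀ k, (Finset.univ.filter fun c : μ.cells => c.1.1 < k).card =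
      (Finset.univ.filter fun c : ν.cells => c.1.1 < k).card) : μ = ν := by
  have key (μ : YoungDiagram) (k : ℕ) :
      (Finset.univ.filter fun c : μ.cells => c.1.1 < k + 1).card =
      (Finset.univ.filter fun c : μ.cells => c.1.1 < k).card + μ.rowLen k := by
    have hs (q : ℕ × ℕ → Prop) [DecidablePred q] :
        (Finset.univ.filter fun c : μ.cells => q c.1).card = (μ.cells.filter q).card := by
      rw [← Finset.card_map (Function.Embedding.subtype _)]
      congr 1
      ext c
      simp only [Finset.mem_map, Finset.mem_filter, Finset.mem_univ, true_and]
      exact ⟨fun ⟨a, ha, h⟩ => h ▸ ⟨a.2, ha⟩, fun h => ⟨⟨c, h.1⟩, h.2, rfl⟩⟩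
    rw [hs (fun c => c.1 < k + 1), hs (fun c => c.1 < k), rowLen_eq_card, row,
      ← Finset.card_union_of_disjoint]
    · congr 1
      ext c
      simp only [Finset.mem_filter, Finset.mem_union]
      have : c.1 < k + 1 ↔ c.1 < k ∨ c.1 = k := by omega
      rw [this]; tauto
    · rw [Finset.disjoint_left]
      intro c hc hc'
      simp only [Finset.mem_filter] at hc hc'
      omega
  have hr (k : ℕ) : μ.rowLen k = ν.rowLen k := by
    have h1 := h (k + 1)
    rw [key, key, h k] at h1
    omega
  ext ⟨i, j⟩
  rw [mem_cells, mem_cells, mem_iff_lt_rowLen, mem_iff_lt_rowLen, hr]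

theorem card_eq_sum_rowLens (μ : YoungDiagram) : μ.card = μ.rowLens.sum := by
  have h : μ.rowLens.sum = ∑ i ∈ Finset.range (μ.colLen 0), μ.rowLen i := rfl
  rw [h, YoungDiagram.card,
    Finset.card_eq_sum_card_fiberwise (f := Prod.fst) (t := Finset.range (μ.colLen 0))]
  · exact Finset.sum_congr rfl fun i _ => (rowLen_eq_card μ).symm
  · intro c hc
    have : (c.1, 0) ∈ μ := μ.up_left_mem le_rfl (Nat.zero_le c.2) hc
    simpa using mem_iff_lt_colLen.1 this

/-- The Young diagram whose row lengths are the parts of a partition. -/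
def ofPartition {n : ℕ} (p : Nat.Partition n) : YoungDiagram :=
  ofRowLens (p.parts.sort (· ≥ ·)) (Multiset.pairwise_sort _ _).sortedGE

theorem rowLens_ofPartition {n : ℕ} (p : Nat.Partition n) :
    (ofPartition p).rowLens = p.parts.sort (· ≥ ·) :=
  rowLens_ofRowLens_eq_self fun _ hx => p.parts_pos ((Multiset.mem_sort _).1 hx)

theorem card_ofPartition {n : ℕ} (p : Nat.Partition n) : (ofPartition p).card = n := by
  rw [card_eq_sum_rowLens, rowLens_ofPartition, ← Multiset.sum_coe, Multiset.sort_eq, p.parts_sum]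

theorem ofPartition_injective {n : ℕ} :
    Function.Injective (ofPartition : Nat.Partition n → YoungDiagram) := by
  intro p q h
  have h1 := congrArg YoungDiagram.rowLens h
  rw [rowLens_ofPartition, rowLens_ofPartition] at h1
  have h2 := congrArg (fun l : List ℕ => (l : Multiset ℕ)) h1
  simp only [Multiset.sort_eq] at h2
  exact Nat.Partition.ext h2

end YoungDiagram

/-! ### Von Neumann's lemma and the symmetric group on tensor powers -/

namespace UnitaryDesign

/-- Numberings of the cells of distinct Young diagrams satisfy, in one of the two orders, von
Neumann's combinatorial lemma. -/
theorem exists_mem_row_mem_col_of_ne {α : Type} {μ ν : YoungDiagram} (e : μ.cells ≃ α)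
    (e' : ν.cells ≃ α) (hne : μ ≠ ν) :
    (∀ σ : Equiv.Perm α, ∃ i j, i ≠ j ∧ (e'.symm i).1.2 = (e'.symm j).1.2 ∧
      (e.symm (σ i)).1.1 = (e.symm (σ j)).1.1) ∨
    (∀ σ : Equiv.Perm α, ∃ i j, i ≠ j ∧ (e.symm i).1.2 = (e.symm j).1.2 ∧
      (e'.symm (σ i)).1.1 = (e'.symm (σ j)).1.1) := by
  by_contra! hcon
  obtain ⟨⟨σ, hσ⟩, τ, hτ⟩ := hcon
  -- A permutation violating the claim gives a bijection of cells separating rows into distinct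
  -- columns, hence a dominance inequality. Violations in both orders force equal diagrams.
  have key {μ ν : YoungDiagram} (e : μ.cells ≃ α) (e' : ν.cells ≃ α) (σ : Equiv.Perm α)
      (hσ : ∀ i j, i ≠ j → (e'.symm i).1.2 = (e'.symm j).1.2 →
        (e.symm (σ i)).1.1 ≠ (e.symm (σ j)).1.1) :=
    YoungDiagram.card_filter_fst_lt_le ((e.trans σ.symm).trans e'.symm) (by
      intro c c' hcc hrow hcol
      refine hσ (σ.symm (e c)) (σ.symm (e c')) (by simpa using hcc) hcol ?_
      simpa using hrow)
  exact hne (YoungDiagram.eq_of_card_filter_fst_lt fun k =>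
    le_antisymm (key e e' σ hσ k) (key e' e τ hτ k))

/-- Right-handed version, for a swap that acts on a tensor before the antisymmetrizer does. -/
theorem fiberAntisymm_mul_swap {α : Type} [Fintype α] [DecidableEq α] {f : α → ℕ} {i j : α}
    (hij : i ≠ j) (h : f i = f j) :
    fiberAntisymm f * MonoidAlgebra.of ℂ _ (Equiv.swap i j) = -fiberAntisymm f := by
  rw [fiberAntisymm, Finset.sum_mul, ← Finset.sum_neg_distrib]
  refine Finset.sum_nbij' (· * Equiv.swap i j) (· * Equiv.swap i j) ?_ ?_ ?_ ?_ ?_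
  · exact fun σ hσ => mul_mem_fiberPerms hσ (swap_mem_fiberPerms h)
  · exact fun σ hσ => mul_mem_fiberPerms hσ (swap_mem_fiberPerms h)
  · intro σ _; simp [mul_assoc]
  · intro σ _; simp [mul_assoc]
  · intro σ _
    rw [smul_mul_assoc, ← map_mul, ← neg_smul]
    simp [Equiv.Perm.sign_swap hij]

section TensorPow

variable {d : ℕ} {ι κ : Type}

theorem permOp_tprod (σ : Equiv.Perm ι) (u : ι → Fin d → ℂ) :
    permOp d σ (PiTensorProduct.tprod ℂ u) = PiTensorProduct.tprod ℂ fun i => u (σ.symm i) :=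
  PiTensorProduct.reindex_tprod σ u

theorem tensorPowOp_tprod (A : Matrix (Fin d) (Fin d) ℂ) (u : ι → Fin d → ℂ) :
    tensorPowOp ι A (PiTensorProduct.tprod ℂ u) =
      PiTensorProduct.tprod ℂ fun i => Matrix.toLin' A (u i) :=
  PiTensorProduct.map_tprod _ _

variable (d ι) in
/-- The representation of the symmetric group on a tensor power. -/
def permRep : Equiv.Perm ι →* Module.End ℂ (TensorPow d ι) where
  toFun := permOp d
  map_one' := by
    refine PiTensorProduct.ext (MultilinearMap.ext fun u => ?_)
    simp only [LinearMap.compMultilinearMap_apply, permOp_tprod]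
    rfl
  map_mul' σ τ := by
    refine PiTensorProduct.ext (MultilinearMap.ext fun u => ?_)
    simp only [LinearMap.compMultilinearMap_apply, Module.End.mul_apply, permOp_tprod]
    rfl

variable (d ι) in
/-- The action of the group algebra of the symmetric group on a tensor power. -/
def permAlg : MonoidAlgebra ℂ (Equiv.Perm ι) →ₐ[ℂ] Module.End ℂ (TensorPow d ι) :=
  MonoidAlgebra.lift ℂ _ _ (permRep d ι)

theorem permAlg_of (σ : Equiv.Perm ι) : permAlg d ι (MonoidAlgebra.of ℂ _ σ) = permOp d σ :=
  MonoidAlgebra.lift_of _ _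

theorem permAlg_comm (x : MonoidAlgebra ℂ (Equiv.Perm ι)) (A : Matrix (Fin d) (Fin d) ℂ) :
    permAlg d ι x * tensorPowOp ι A = tensorPowOp ι A * permAlg d ι x := by
  induction x using MonoidAlgebra.induction_on with
  | of σ => rw [permAlg_of]; exact permOp_comm σ A
  | add a b ha hb => rw [map_add, add_mul, mul_add, ha, hb]
  | smul c a ha => rw [map_smul, smul_mul_assoc, mul_smul_comm, ha]

variable (d) in
/-- Renaming the tensor factors. -/
def renameEquiv (e : ι ≃ κ) : TensorPow d ι ≃ₗ[ℂ] TensorPow d κ :=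
  PiTensorProduct.reindex ℂ (fun _ : ι => (Fin d → ℂ)) e

theorem renameEquiv_tprod (e : ι ≃ κ) (u : ι → Fin d → ℂ) :
    renameEquiv d e (PiTensorProduct.tprod ℂ u) = PiTensorProduct.tprod ℂ fun i => u (e.symm i) :=
  PiTensorProduct.reindex_tprod e u

theorem renameEquiv_comp_permOp (e : ι ≃ κ) (σ : Equiv.Perm ι) :
    (renameEquiv d e).toLinearMap ∘ₗ permOp d σ =
      permOp d (e.permCongr σ) ∘ₗ (renameEquiv d e).toLinearMap := by
  refine PiTensorProduct.ext (MultilinearMap.ext fun u => ?_)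
  simp only [LinearMap.compMultilinearMap_apply, LinearMap.comp_apply, LinearEquiv.coe_coe,
    permOp_tprod, renameEquiv_tprod]
  refine congrArg _ (funext fun i => congrArg u ?_)
  obtain ⟨k, rfl⟩ := (e.permCongr σ).surjective i
  rw [Equiv.symm_apply_apply, Equiv.permCongr_apply, e.symm_apply_apply, σ.symm_apply_apply]

theorem renameEquiv_comp_tensorPowOp (e : ι ≃ κ) (A : Matrix (Fin d) (Fin d) ℂ) :
    (renameEquiv d e).toLinearMap ∘ₗ tensorPowOp ι A =
      tensorPowOp κ A ∘ₗ (renameEquiv d e).toLinearMap := by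
  refine PiTensorProduct.ext (MultilinearMap.ext fun u => ?_)
  simp only [LinearMap.compMultilinearMap_apply, LinearMap.comp_apply, LinearEquiv.coe_coe,
    tensorPowOp_tprod, renameEquiv_tprod]

/-- Antisymmetrizing more than `d` tensor factors gives zero. -/
theorem permAlg_fiberAntisymm_eq_zero [Fintype ι] [DecidableEq ι] (g : ι → ℕ) (m : ℕ)
    (h : d < (Finset.univ.filter fun x => g x = m).card) :
    permAlg d ι (fiberAntisymm g) = 0 := by
  refine PiTensorProduct.ext (Module.Basis.ext_multilinear (fun _ => Pi.basisFun ℂ (Fin d)) ?_)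
  intro v
  -- Pigeonhole: two antisymmetrized positions carry the same basis vector. Swapping them fixes the
  -- tensor but negates its antisymmetrization.
  obtain ⟨i, hi, j, hj, hij, hv⟩ := Finset.exists_ne_map_eq_of_card_lt_of_maps_to
    (s := Finset.univ.filter fun x => g x = m) (t := (Finset.univ : Finset (Fin d)))
    (by simpa using h) (f := v) (fun _ _ => by simp)
  simp only [Finset.mem_filter, Finset.mem_univ, true_and] at hi hj
  set u := PiTensorProduct.tprod ℂ fun i => Pi.basisFun ℂ (Fin d) (v i) with hu
  have h1 : permOp d (Equiv.swap i j) u = u := by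
    rw [hu, permOp_tprod]
    congr 1
    ext x : 1
    rw [Equiv.symm_swap]
    congr 1
    by_cases h1 : x = i
    · rw [h1, Equiv.swap_apply_left, hv]
    · by_cases h2 : x = j
      · rw [h2, Equiv.swap_apply_right, hv]
      · rw [Equiv.swap_apply_of_ne_of_ne h1 h2]
  have h2 := congrArg (fun z => permAlg d ι z u)
    (fiberAntisymm_mul_swap (f := g) hij (hi.trans hj.symm))
  simp only [map_mul, permAlg_of, Module.End.mul_apply, h1, map_neg, LinearMap.neg_apply] at h2
  have h3 := add_eq_zero_iff_eq_neg.2 h2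
  rw [← two_smul ℂ] at h3
  exact (smul_eq_zero.1 h3).resolve_left two_ne_zero

end TensorPow

/-! ### Intertwiners between the tensor power and the Weyl modules -/

section Weyl

variable {d : ℕ} {κ : Type} {γ : YoungDiagram} (e : γ.cells ≃ κ)

/-- The Young symmetrizer of a numbering of the cells of a Young diagram. -/
def numberedYoungElement [Fintype κ] [DecidableEq κ] : MonoidAlgebra ℂ (Equiv.Perm κ) :=
  youngElement (fun i => (e.symm i).1.1) (fun i => (e.symm i).1.2)

theorem fiberPerms_comp_symm [Fintype κ] [DecidableEq κ] (f : γ.cells → ℕ) :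
    fiberPerms (fun i => f (e.symm i)) =
      (Finset.univ.filter fun σ : Equiv.Perm γ.cells => ∀ c, f (σ c) = f c).map
        e.permCongr.toEmbedding := by
  ext σ
  rw [mem_fiberPerms, Finset.mem_map_equiv, Finset.mem_filter]
  refine ⟨fun h => ⟨Finset.mem_univ _, fun c => ?_⟩, fun h i => ?_⟩
  · simpa [Equiv.permCongr_symm] using h (e c)
  · simpa [Equiv.permCongr_symm] using h.2 (e.symm i)

/-- Conjugation by the numbering `e` matches row and column stabilizers and preserves signs, so
facts about the group algebra on `κ` apply to the symmetrizer indexed by cells. -/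
theorem renameEquiv_comp_youngSymmetrizer [Fintype κ] [DecidableEq κ] :
    (renameEquiv d e).toLinearMap ∘ₗ youngSymmetrizer d γ =
      permAlg d κ (numberedYoungElement e) ∘ₗ (renameEquiv d e).toLinearMap := by
  have hrow : (renameEquiv d e).toLinearMap ∘ₗ (∑ σ ∈ rowPerms γ, permOp d σ) =
      permAlg d κ (fiberSymm fun i => (e.symm i).1.1) ∘ₗ (renameEquiv d e).toLinearMap := by
    rw [fiberSymm, fiberPerms_comp_symm e (fun c => c.1.1), Finset.sum_map, map_sum]
    refine LinearMap.ext fun v => ?_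
    simp only [LinearMap.comp_apply, LinearMap.sum_apply, map_sum]
    refine Finset.sum_congr rfl fun σ _ => ?_
    rw [permAlg_of]
    exact LinearMap.congr_fun (renameEquiv_comp_permOp e σ) v
  have hcol : (renameEquiv d e).toLinearMap ∘ₗ
      (∑ σ ∈ colPerms γ, ((Equiv.Perm.sign σ : ℤ) : ℂ) • permOp d σ) =
      permAlg d κ (fiberAntisymm fun i => (e.symm i).1.2) ∘ₗ (renameEquiv d e).toLinearMap := by
    rw [fiberAntisymm, fiberPerms_comp_symm e (fun c => c.1.2), Finset.sum_map, map_sum]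
    refine LinearMap.ext fun v => ?_
    simp only [LinearMap.comp_apply, LinearMap.sum_apply, map_sum]
    refine Finset.sum_congr rfl fun σ _ => ?_
    rw [map_smul, permAlg_of, LinearMap.smul_apply, map_smul, LinearMap.smul_apply,
      Equiv.coe_toEmbedding, Equiv.Perm.sign_permCongr]
    exact congrArg _ (LinearMap.congr_fun (renameEquiv_comp_permOp e σ) v)
  rw [youngSymmetrizer, numberedYoungElement, youngElement, map_mul, Module.End.mul_eq_comp,
    Module.End.mul_eq_comp, ← LinearMap.comp_assoc, hcol, LinearMap.comp_assoc, hrow,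
    LinearMap.comp_assoc]

/-- A linear map from `Π_γ` to a tensor power given by an element of the group algebra. -/
def weylInclusion (x : MonoidAlgebra ℂ (Equiv.Perm κ)) : weylSpace d γ →ₗ[ℂ] TensorPow d κ :=
  permAlg d κ x ∘ₗ (renameEquiv d e).toLinearMap ∘ₗ (weylSpace d γ).subtype

/-- A linear map from a tensor power to `Π_γ` given by an element of the group algebra. -/
def weylProjection (x : MonoidAlgebra ℂ (Equiv.Perm κ)) : TensorPow d κ →ₗ[ℂ] weylSpace d γ :=
  (youngSymmetrizer d γ).rangeRestrict ∘ₗ (renameEquiv d e).symm.toLinearMap ∘ₗ permAlg d κ x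

theorem weylInclusion_comp_weylRep (x : MonoidAlgebra ℂ (Equiv.Perm κ)) (V : U d) :
    weylInclusion e x ∘ₗ weylRep d γ V = tensorPowRep d κ V ∘ₗ weylInclusion e x := by
  refine LinearMap.ext fun v => ?_
  have h1 := LinearMap.congr_fun (renameEquiv_comp_tensorPowOp e V.1) v.1
  have h2 := LinearMap.congr_fun (permAlg_comm x V.1) (renameEquiv d e v.1)
  calc _ = permAlg d κ x (renameEquiv d e (tensorPowOp γ.cells V.1 v.1)) := rfl
    _ = permAlg d κ x (tensorPowOp κ V.1 (renameEquiv d e v.1)) := congrArg _ h1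
    _ = _ := h2

theorem weylProjection_comp_tensorPowRep (x : MonoidAlgebra ℂ (Equiv.Perm κ)) (V : U d) :
    weylProjection e x ∘ₗ tensorPowRep d κ V = weylRep d γ V ∘ₗ weylProjection e x := by
  refine LinearMap.ext fun v => Subtype.ext ?_
  have h1 := LinearMap.congr_fun (permAlg_comm x V.1) v
  have h2 : (renameEquiv d e).symm (tensorPowOp κ V.1 (permAlg d κ x v)) =
      tensorPowOp γ.cells V.1 ((renameEquiv d e).symm (permAlg d κ x v)) := by
    rw [LinearEquiv.symm_apply_eq]
    have := LinearMap.congr_fun (renameEquiv_comp_tensorPowOp e V.1)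
      ((renameEquiv d e).symm (permAlg d κ x v))
    simpa using this.symm
  have h3 := LinearMap.congr_fun (youngSymmetrizer_comm γ V.1).eq
    ((renameEquiv d e).symm (permAlg d κ x v))
  calc _ = youngSymmetrizer d γ
        ((renameEquiv d e).symm ((permAlg d κ x * tensorPowOp κ V.1) v)) := rfl
    _ = youngSymmetrizer d γ
        ((renameEquiv d e).symm ((tensorPowOp κ V.1 * permAlg d κ x) v)) := by rw [h1]
    _ = youngSymmetrizer d γ
        (tensorPowOp γ.cells V.1 ((renameEquiv d e).symm (permAlg d κ x v))) := congrArg _ h2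
    _ = _ := h3

/-- Factoring the symmetrizer through its range is what makes every `x * c * y` a composite of
intertwiners through `Π_γ`. -/
theorem weylInclusion_comp_weylProjection [Fintype κ] [DecidableEq κ] (x y : MonoidAlgebra ℂ (Equiv.Perm κ)) :
    weylInclusion (d := d) e x ∘ₗ weylProjection e y =
      permAlg d κ (x * numberedYoungElement e * y) := by
  refine LinearMap.ext fun v => ?_
  have h := LinearMap.congr_fun (renameEquiv_comp_youngSymmetrizer (d := d) e)
    ((renameEquiv d e).symm (permAlg d κ y v))
  rw [map_mul, map_mul]
  refine congrArg (permAlg d κ x) (h.trans ?_)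
  simp

/-- Column `0` has more than `d` cells, too many to antisymmetrize in dimension `d`. -/
theorem permAlg_numberedYoungElement_eq_zero [Fintype κ] [DecidableEq κ] (h : d < γ.colLen 0) :
    permAlg d κ (numberedYoungElement e) = 0 := by
  rw [numberedYoungElement, youngElement, map_mul, permAlg_fiberAntisymm_eq_zero _ 0, zero_mul]
  refine h.trans_le ?_
  rw [← Finset.card_range (γ.colLen 0), ← Fintype.card_coe]
  refine Finset.card_le_card_of_injOn
    (fun i => e ⟨(i.1, 0), (YoungDiagram.mem_cells _).2 <| YoungDiagram.mem_iff_lt_colLen.2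
      (Finset.mem_range.1 i.2)⟩) ?_ ?_
  · intro i _
    simp
  · intro i _ i' _ h
    exact Subtype.ext (congrArg (fun c : γ.cells => c.1.1) (e.injective h))

end Weyl

/-- The tensor power is a sum of copies of the representations `Π_γ`: the identity is a linear
combination of composites of intertwiners through the `Π_γ`. -/
theorem one_mem_span_comp_weylSpace (d t : ℕ) :
    (1 : Module.End ℂ (TensorPow d (Fin t))) ∈ Submodule.span ℂ
      {z | ∃ γ ∈ diagrams t d, ∃ (φ : weylSpace d γ →ₗ[ℂ] TensorPow d (Fin t))
        (ψ : TensorPow d (Fin t) →ₗ[ℂ] weylSpace d γ),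
        (∀ V, φ ∘ₗ weylRep d γ V = tensorPowRep d (Fin t) V ∘ₗ φ) ∧
        (∀ V, ψ ∘ₗ tensorPowRep d (Fin t) V = weylRep d γ V ∘ₗ ψ) ∧ z = φ ∘ₗ ψ} := by
  have hcard (p : Nat.Partition (Fintype.card (Fin t))) :
      Nonempty ((YoungDiagram.ofPartition p).cells ≃ Fin t) := by
    refine ⟨Fintype.equivOfCardEq ?_⟩
    rw [Fintype.card_coe]
    exact YoungDiagram.card_ofPartition p
  let e := fun p => (hcard p).some
  have h1 := one_mem_span_youngElement (fun p i => ((e p).symm i).1.1)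
    (fun p i => ((e p).symm i).1.2)
    (fun p x y hx hy => (e p).symm.injective (Subtype.ext (Prod.ext hx hy)))
    (fun p q hpq => exists_mem_row_mem_col_of_ne (e p) (e q)
      (YoungDiagram.ofPartition_injective.ne hpq))
  have h2 := Submodule.mem_map_of_mem (f := (permAlg d (Fin t)).toLinearMap) h1
  rw [Submodule.map_span, AlgHom.toLinearMap_apply, map_one] at h2
  refine Submodule.span_le.2 ?_ h2
  rintro _ ⟨_, ⟨p, x, y, rfl⟩, rfl⟩
  -- Partitions with more than `d` parts lie outside `diagrams t d`, but their symmetrizers act as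
  -- zero.
  by_cases hd : (YoungDiagram.ofPartition p).colLen 0 ≤ d
  · refine Submodule.subset_span ⟨YoungDiagram.ofPartition p, ⟨?_, hd⟩, weylInclusion (e p) x,
      weylProjection (e p) y, weylInclusion_comp_weylRep _ _,
      weylProjection_comp_tensorPowRep _ _, ?_⟩
    · rw [YoungDiagram.card_ofPartition, Fintype.card_fin]
    · rw [weylInclusion_comp_weylProjection]; rfl
  · have h0 := permAlg_numberedYoungElement_eq_zero (e p) (not_le.1 hd)
    have : permAlg d (Fin t) (x * numberedYoungElement (e p) * y) = 0 := by
      rw [map_mul, map_mul, h0, mul_zero, zero_mul]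
    exact Set.mem_of_eq_of_mem this (Submodule.zero_mem _)

end UnitaryDesign

/-! ### Ordered products and Schur's lemma -/

/-- A product of operators that preserve a subspace, one of which maps everything into it, maps
everything into it. -/
theorem List.prod_apply_mem_of_exists {k Z : Type*} [Semiring k] [AddCommMonoid Z] [Module k Z]
    (P : Submodule k Z) (L : List (Module.End k Z)) (hP : ∀ T ∈ L, ∀ z ∈ P, T z ∈ P)
    (hL : ∃ T ∈ L, ∀ z, T z ∈ P) (z : Z) : L.prod z ∈ P := by
  induction L with
  | nil => obtain ⟨T, hT, -⟩ := hL; simp at hT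
  | cons S L ih =>
    rw [List.prod_cons, Module.End.mul_apply]
    obtain ⟨T, hT, hTz⟩ := hL
    rcases List.mem_cons.1 hT with rfl | hT
    · exact hTz _
    · exact hP S List.mem_cons_self _
        (ih (fun T hT => hP T (List.mem_cons_of_mem _ hT)) ⟨T, hT, hTz⟩)

/-- The sum over tuples of an ordered product is the ordered product of the sums. -/
theorem Fin.sum_prod_ofFn {R : Type*} [Semiring R] {n : ℕ} {X : Fin n → Type*}
    [∀ j, Fintype (X j)] (F : ∀ j, X j → R) :
    ∑ h : ∀ j, X j, (List.ofFn fun j => F j (h j)).prod =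
      (List.ofFn fun j => ∑ g : X j, F j g).prod := by
  induction n with
  | zero => simp
  | succ n ih =>
    rw [← (Fin.consEquiv X).sum_comp, Fintype.sum_prod_type]
    simp only [List.ofFn_succ, List.prod_cons, Fin.consEquiv_apply, Fin.cons_zero, Fin.cons_succ]
    rw [← ih fun j => F j.succ, Finset.sum_mul_sum]

/-- Schur's lemma: the operators commuting with an irreducible representation are scalars. -/
theorem Representation.IsIrreducible.exists_eq_smul_id {k H V : Type*} [Field k] [IsAlgClosed k]
    [Monoid H] [AddCommGroup V] [Module k V] [FiniteDimensional k V] (ρ : Representation k H V)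
    [Representation.IsIrreducible ρ] (X : V →ₗ[k] V) (hX : ∀ u, X ∘ₗ ρ u = ρ u ∘ₗ X) :
    ∃ c : k, X = c • LinearMap.id := by
  let Y : Representation.IntertwiningMap ρ ρ := ⟨X, hX⟩
  obtain ⟨c, hc⟩ :=
    (algebraMap_intertwiningMap_bijective_of_isAlgClosed (ρ := ρ)).2 Y
  exact ⟨c, (congrArg Representation.IntertwiningMap.toLinearMap hc).symm⟩

namespace UnitaryDesign

/-! ### Averaging over products of subgroups -/

section Averages

variable {d ℓ : ℕ} (G : Fin ℓ → Subgroup (U d)) [∀ j, Fintype (G j)]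

theorem sum_rep_tupleProd {Z : Type*} [AddCommMonoid Z] [Module ℂ Z]
    (ρ : Representation ℂ (U d) Z) :
    ∑ h : ∀ j, G j, ρ (tupleProd G h) = (List.ofFn fun j => ∑ g : G j, ρ g).prod := by
  rw [← Fin.sum_prod_ofFn fun j (g : G j) => ρ g]
  refine Finset.sum_congr rfl fun h _ => ?_
  rw [tupleProd, map_list_prod, List.map_ofFn]
  rfl

/-- The vectors fixed by the unitary group. -/
def fixedVectors {Z : Type*} [AddCommMonoid Z] [Module ℂ Z]
    (ρ : Representation ℂ (U d) Z) : Submodule ℂ Z where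
  carrier := {z | ∀ V, ρ V z = z}
  add_mem' ha hb V := by rw [map_add, ha V, hb V]
  zero_mem' V := map_zero _
  smul_mem' c z hz V := by rw [map_smul, hz V]

theorem mem_fixedVectors_linHom {V W : Type*} [AddCommMonoid V] [Module ℂ V] [AddCommMonoid W]
    [Module ℂ W] {ρ : Representation ℂ (U d) V} {τ : Representation ℂ (U d) W} {X : V →ₗ[ℂ] W} :
    X ∈ fixedVectors (Representation.linHom ρ τ) ↔ ∀ u, X ∘ₗ ρ u = τ u ∘ₗ X := by
  refine forall_congr' fun u => ?_
  rw [Representation.linHom_apply]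
  have h (u v) : ρ u (ρ u⁻¹ v) = v := by
    rw [← Module.End.mul_apply, ← map_mul, mul_inv_cancel, map_one, Module.End.one_apply]
  refine ⟨fun hX => LinearMap.ext fun v => ?_, fun hX => LinearMap.ext fun v => ?_⟩
  · have h1 := LinearMap.congr_fun hX (ρ u v)
    have h2 := h u⁻¹ v
    rw [inv_inv] at h2
    simp only [LinearMap.comp_apply, h2] at h1 ⊢
    exact h1.symm
  · have h1 := LinearMap.congr_fun hX (ρ u⁻¹ v)
    simp only [LinearMap.comp_apply, h] at h1 ⊢
    exact h1.symm

/-- If averaging over one of the subgroups yields vectors invariant under the whole unitary group,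
then so does averaging over their product. -/
theorem sum_rep_tupleProd_mem_fixedVectors {Z : Type*} [AddCommMonoid Z] [Module ℂ Z]
    (ρ : Representation ℂ (U d) Z) (h : ∃ j, ∀ z, ∑ g : G j, ρ g z ∈ fixedVectors ρ) (z : Z) :
    ∑ h : ∀ j, G j, ρ (tupleProd G h) z ∈ fixedVectors ρ := by
  rw [← LinearMap.sum_apply, sum_rep_tupleProd]
  refine List.prod_apply_mem_of_exists _ _ ?_ ?_ z
  -- On an invariant vector each subgroup sum is a sum of copies of that vector, so it stays
  -- invariant.
  · intro T hT z hz
    obtain ⟨j, rfl⟩ := List.mem_ofFn.1 hT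
    rw [LinearMap.sum_apply]
    exact sum_mem fun g _ => by rw [hz]; exact hz
  · obtain ⟨j, hj⟩ := h
    exact ⟨_, List.mem_ofFn.2 ⟨j, rfl⟩, fun z => by rw [LinearMap.sum_apply]; exact hj z⟩

variable {G}

/-- The averaged operators are intertwiners for the subgroup. -/
theorem sum_linHom_comp {V W : Type*} [AddCommMonoid V] [Module ℂ V] [AddCommMonoid W] [Module ℂ W]
    (ρ : Representation ℂ (U d) V) (τ : Representation ℂ (U d) W) (H : Subgroup (U d)) [Fintype H]
    (X : V →ₗ[ℂ] W) (u : H) :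
    (∑ g : H, Representation.linHom ρ τ g X) ∘ₗ ρ u =
      τ u ∘ₗ ∑ g : H, Representation.linHom ρ τ g X := by
  have h : Representation.linHom ρ τ u (∑ g : H, Representation.linHom ρ τ g X) =
      ∑ g : H, Representation.linHom ρ τ g X := by
    rw [map_sum]
    refine Fintype.sum_equiv (Equiv.mulLeft u) _ _ fun g => ?_
    rw [Equiv.coe_mulLeft, Subgroup.coe_mul, map_mul, Module.End.mul_apply]
  conv_lhs => rw [← h]
  rw [Representation.linHom_apply]
  refine LinearMap.ext fun v => ?_
  simp only [LinearMap.comp_apply]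
  rw [← Module.End.mul_apply (ρ _) (ρ _), ← map_mul, inv_mul_cancel, map_one, Module.End.one_apply]

/-- Schur's lemma for `H` makes the sum a scalar, and scalars commute with all of `U(d)`, not just
with `H`. -/
theorem sum_linHom_mem_fixedVectors_of_isIrreducible {γ : YoungDiagram} (H : Subgroup (U d))
    [Fintype H]
    (hH : Representation.IsIrreducible (k := ℂ) (V := weylSpace d γ) (weylRepRes γ H))
    (X : weylSpace d γ →ₗ[ℂ] weylSpace d γ) :
    ∑ g : H, Representation.linHom (weylRep d γ) (weylRep d γ) g X ∈
      fixedVectors (Representation.linHom (weylRep d γ) (weylRep d γ)) := by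
  have hfin : Module.Finite ℂ (weylSpace d γ) := Module.Finite.range (youngSymmetrizer d γ)
  obtain ⟨c, hY⟩ := Representation.IsIrreducible.exists_eq_smul_id (V := weylSpace d γ)
    (weylRepRes γ H) (∑ g : H, Representation.linHom (weylRep d γ) (weylRep d γ) g X)
    fun u => sum_linHom_comp _ _ H X u
  rw [hY, mem_fixedVectors_linHom]
  exact fun g => LinearMap.ext fun v => (map_smul (weylRep d γ g) c v).symm

/-- For each pair of diagrams one good subgroup suffices, whatever its position in the product:
diagonal blocks use irreducibility, off-diagonal ones the lack of intertwiners. -/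
theorem sum_linHom_weylRep_mem_fixedVectors {t : ℕ}
    (hirr : ∀ γ ∈ diagrams t d,
      ∃ j, Representation.IsIrreducible (k := ℂ) (V := weylSpace d γ) (weylRepRes γ (G j)))
    (hint : ∀ γ ∈ diagrams t d, ∀ η ∈ diagrams t d, γ ≠ η →
      ∃ j, ∀ A : Representation.IntertwiningMap (weylRepRes γ (G j)) (weylRepRes η (G j)), A = 0)
    {γ η : YoungDiagram} (hγ : γ ∈ diagrams t d) (hη : η ∈ diagrams t d)
    (X : weylSpace d γ →ₗ[ℂ] weylSpace d η) :
    ∑ h : ∀ j, G j, Representation.linHom (weylRep d γ) (weylRep d η) (tupleProd G h) X ∈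
      fixedVectors (Representation.linHom (weylRep d γ) (weylRep d η)) := by
  refine sum_rep_tupleProd_mem_fixedVectors G _ ?_ X
  by_cases h : γ = η
  · subst h
    obtain ⟨j, hj⟩ := hirr γ hγ
    exact ⟨j, sum_linHom_mem_fixedVectors_of_isIrreducible (G j) hj⟩
  · obtain ⟨j, hj⟩ := hint γ hγ η hη h
    refine ⟨j, fun X => ?_⟩
    have h0 := congrArg Representation.IntertwiningMap.toLinearMap
      (hj ⟨∑ g : G j, Representation.linHom (weylRep d γ) (weylRep d η) g X,
        fun u => sum_linHom_comp _ _ (G j) X u⟩)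
    have h1 : ∑ g : G j, Representation.linHom (weylRep d γ) (weylRep d η) g X = 0 := h0
    rw [h1]
    exact zero_mem _

theorem conjOp_eq_linHom {t : ℕ} (M : Module.End ℂ (TensorPow d (Fin t))) (V : U d) :
    conjOp t M V =
      Representation.linHom (tensorPowRep d (Fin t)) (tensorPowRep d (Fin t)) V M := rfl

/-- The average of `M` over the product of the subgroups commutes with the unitary group. -/
theorem sum_conjOp_tupleProd_comm {t : ℕ}
    (hirr : ∀ γ ∈ diagrams t d,
      ∃ j, Representation.IsIrreducible (k := ℂ) (V := weylSpace d γ) (weylRepRes γ (G j)))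
    (hint : ∀ γ ∈ diagrams t d, ∀ η ∈ diagrams t d, γ ≠ η →
      ∃ j, ∀ A : Representation.IntertwiningMap (weylRepRes γ (G j)) (weylRepRes η (G j)), A = 0)
    (M : Module.End ℂ (TensorPow d (Fin t))) (V : U d) :
    conjOp t (∑ h : ∀ j, G j, conjOp t M (tupleProd G h)) V =
      ∑ h : ∀ j, G j, conjOp t M (tupleProd G h) := by
  set S := ∑ h : ∀ j, G j, conjOp t M (tupleProd G h) with hS
  set ρ := tensorPowRep d (Fin t)
  have hblock {γ η : YoungDiagram} (hγ : γ ∈ diagrams t d) (hη : η ∈ diagrams t d)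
      (φ : weylSpace d γ →ₗ[ℂ] TensorPow d (Fin t)) (ψ : TensorPow d (Fin t) →ₗ[ℂ] weylSpace d η)
      (hφ : ∀ V, φ ∘ₗ weylRep d γ V = ρ V ∘ₗ φ) (hψ : ∀ V, ψ ∘ₗ ρ V = weylRep d η V ∘ₗ ψ) :
      ψ ∘ₗ (S * ρ V - ρ V * S) ∘ₗ φ = 0 := by
    -- Since `φ` and `ψ` are equivariant, compression to a block commutes with conjugation.
    have h1 : ψ ∘ₗ S ∘ₗ φ = ∑ h : ∀ j, G j,
        Representation.linHom (weylRep d γ) (weylRep d η) (tupleProd G h) (ψ ∘ₗ M ∘ₗ φ) := by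
      refine LinearMap.ext fun v => ?_
      simp only [hS, LinearMap.comp_apply, LinearMap.sum_apply, map_sum]
      refine Finset.sum_congr rfl fun h _ => ?_
      rw [conjOp_eq_linHom, Representation.linHom_apply, Representation.linHom_apply]
      have h2 := LinearMap.congr_fun (hφ (tupleProd G h)⁻¹) v
      have h3 (w) := LinearMap.congr_fun (hψ (tupleProd G h)) w
      simp only [LinearMap.comp_apply] at h2 h3 ⊢
      rw [h2, h3]
    have h2 := mem_fixedVectors_linHom.1
      (h1 ▸ sum_linHom_weylRep_mem_fixedVectors hirr hint hγ hη (ψ ∘ₗ M ∘ₗ φ)) V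
    refine LinearMap.ext fun v => ?_
    have h3 := LinearMap.congr_fun h2 v
    have h4 := LinearMap.congr_fun (hφ V) v
    have h5 := LinearMap.congr_fun (hψ V) (S (φ v))
    simp only [LinearMap.comp_apply] at h3 h4 h5
    simp only [LinearMap.comp_apply, LinearMap.sub_apply, Module.End.mul_apply, map_sub,
      LinearMap.zero_apply]
    rw [h5, ← h4, h3, sub_self]
  -- The commutator vanishes between any two elements of the span; since 1 belongs to it, taking `a
  -- = b = 1` finishes.
  have hspan : ∀ a ∈ Submodule.span ℂ
      {z | ∃ γ ∈ diagrams t d, ∃ (φ : weylSpace d γ →ₗ[ℂ] TensorPow d (Fin t))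
        (ψ : TensorPow d (Fin t) →ₗ[ℂ] weylSpace d γ),
        (∀ V, φ ∘ₗ weylRep d γ V = ρ V ∘ₗ φ) ∧
        (∀ V, ψ ∘ₗ ρ V = weylRep d γ V ∘ₗ ψ) ∧ z = φ ∘ₗ ψ},
      ∀ b ∈ Submodule.span ℂ
      {z | ∃ γ ∈ diagrams t d, ∃ (φ : weylSpace d γ →ₗ[ℂ] TensorPow d (Fin t))
        (ψ : TensorPow d (Fin t) →ₗ[ℂ] weylSpace d γ),
        (∀ V, φ ∘ₗ weylRep d γ V = ρ V ∘ₗ φ) ∧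
        (∀ V, ψ ∘ₗ ρ V = weylRep d γ V ∘ₗ ψ) ∧ z = φ ∘ₗ ψ},
      a * (S * ρ V - ρ V * S) * b = 0 := by
    intro a ha b hb
    induction ha using Submodule.span_induction with
    | zero => rw [zero_mul, zero_mul]
    | add a a' _ _ ha ha' => rw [add_mul, add_mul, ha, ha', add_zero]
    | smul r a _ ha => rw [smul_mul_assoc, smul_mul_assoc, ha, smul_zero]
    | mem a h =>
      obtain ⟨η, hη, φ, ψ, hφ, hψ, rfl⟩ := h
      induction hb using Submodule.span_induction with
      | zero => rw [mul_zero]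
      | add a a' _ _ ha ha' => rw [mul_add, ha, ha', add_zero]
      | smul r a _ ha => rw [mul_smul_comm, ha, smul_zero]
      | mem b h =>
        obtain ⟨γ, hγ, φ', ψ', hφ', hψ', rfl⟩ := h
        refine LinearMap.ext fun v => ?_
        have h1 := LinearMap.congr_fun (hblock hγ hη φ' ψ hφ' hψ) (ψ' v)
        exact (congrArg φ h1).trans (map_zero φ)
  have hcomm : S * ρ V = ρ V * S := by
    have := hspan 1 (one_mem_span_comp_weylSpace d t) 1 (one_mem_span_comp_weylSpace d t)
    rw [one_mul, mul_one] at this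
    exact sub_eq_zero.1 this
  have hinv : ρ V * ρ V⁻¹ = 1 := by rw [← map_mul, mul_inv_cancel, map_one]
  calc conjOp t S V = ρ V * S * ρ V⁻¹ := rfl
    _ = S := by rw [← hcomm, mul_assoc, hinv, mul_one]

end Averages

/-! ### Haar integration and the weights -/

open MeasureTheory

/-- A right translate of Haar measure is again a Haar probability measure, and such a measure is
unique. -/
instance instIsMulRightInvariant (d : ℕ) : (haar d).IsMulRightInvariant where
  map_mul_right_eq_self g := by
    have : IsProbabilityMeasure ((haar d).map (· * g)) :=
      Measure.isProbabilityMeasure_map (measurable_mul_const g).aemeasurable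
    exact Measure.isHaarMeasure_eq_of_isProbabilityMeasure _ _

/-- Shows `A^{⊗ι}` to be polynomial in the entries of `A`, from which continuity of the integrands
follows. -/
theorem tensorPowOp_eq_sum {d : ℕ} {ι : Type} [Fintype ι] [DecidableEq ι]
    (A : Matrix (Fin d) (Fin d) ℂ) :
    tensorPowOp ι A = ∑ k : ι → Fin d × Fin d, (∏ i, A (k i).1 (k i).2) •
      PiTensorProduct.map fun i => Matrix.toLin' (Matrix.single (k i).1 (k i).2 1) := by
  have h : Matrix.toLin' A = ∑ p : Fin d × Fin d,
      A p.1 p.2 • Matrix.toLin' (Matrix.single p.1 p.2 1) := by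
    conv_lhs => rw [Matrix.matrix_eq_sum_single A]
    rw [Fintype.sum_prod_type, map_sum]
    refine Finset.sum_congr rfl fun i _ => ?_
    rw [map_sum]
    refine Finset.sum_congr rfl fun j _ => ?_
    rw [← map_smul, Matrix.smul_single, smul_eq_mul, mul_one]
  rw [tensorPowOp, h]
  have h2 := (PiTensorProduct.mapMultilinear ℂ (fun _ : ι => Fin d → ℂ)
    (fun _ : ι => Fin d → ℂ)).map_sum fun (_ : ι) (p : Fin d × Fin d) =>
      A p.1 p.2 • Matrix.toLin' (Matrix.single p.1 p.2 1)
  refine h2.trans (Finset.sum_congr rfl fun k _ => ?_)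
  exact MultilinearMap.map_smul_univ _ _ _

theorem continuous_apply_conjOp {d t : ℕ} (M : Module.End ℂ (TensorPow d (Fin t)))
    (f : Module.Dual ℂ (Module.End ℂ (TensorPow d (Fin t)))) :
    Continuous fun V : U d => f (conjOp t M V) := by
  have hentry (i j : Fin d) : Continuous fun V : U d => V.1 i j :=
    continuous_subtype_val.matrix_elem i j
  have hstar (i j : Fin d) : Continuous fun V : U d => (star V.1) i j :=
    (continuous_star.comp continuous_subtype_val).matrix_elem i j
  simp only [conjOp, tensorPowOp_eq_sum, Finset.sum_mul, Finset.mul_sum, map_sum, smul_mul_assoc,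
    mul_smul_comm, map_smul, smul_eq_mul]
  exact continuous_finsetSum _ fun k _ => continuous_finsetSum _ fun l _ =>
    (continuous_finsetProd _ fun i _ => hstar _ _).mul
      ((continuous_finsetProd _ fun i _ => hentry _ _).mul continuous_const)

theorem conjOp_conjOp {d t : ℕ} (M : Module.End ℂ (TensorPow d (Fin t))) (V W : U d) :
    conjOp t (conjOp t M W) V = conjOp t M (V * W) := by
  have h (V : U d) (M) : conjOp t M V =
    tensorPowRep d (Fin t) V * M * tensorPowRep d (Fin t) V⁻¹ := rfl
  simp only [h, mul_inv_rev, map_mul, mul_assoc]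

theorem conjOp_sum {d t : ℕ} {X : Type*} (s : Finset X)
    (M : X → Module.End ℂ (TensorPow d (Fin t))) (V : U d) :
    conjOp t (∑ x ∈ s, M x) V = ∑ x ∈ s, conjOp t (M x) V := by
  simp only [conjOp, Finset.mul_sum, Finset.sum_mul]

/-- If the sum of the conjugates of `M` over a finite family commutes with the unitary group, it is
a multiple of the Haar average of `M`. -/
theorem card_mul_integral_conjOp {d t : ℕ} {X : Type*} [Fintype X] (v : X → U d)
    (M : Module.End ℂ (TensorPow d (Fin t)))
    (h : ∀ V, conjOp t (∑ x, conjOp t M (v x)) V = ∑ x, conjOp t M (v x))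
    (f : Module.Dual ℂ (Module.End ℂ (TensorPow d (Fin t)))) :
    (Fintype.card X : ℂ) * ∫ V, f (conjOp t M V) ∂(haar d) = f (∑ x, conjOp t M (v x)) := by
  have h1 : ∫ V, f (conjOp t (∑ x, conjOp t M (v x)) V) ∂(haar d) =
      f (∑ x, conjOp t M (v x)) := by
    simp only [h]
    simp
  rw [← h1]
  simp only [conjOp_sum, map_sum, conjOp_conjOp]
  rw [integral_finsetSum]
  -- Each integrand is a right translate by `v x`, so every term contributes the same integral.
  · rw [Finset.sum_congr rfl fun x _ =>
      integral_mul_right_eq_self (fun V => f (conjOp t M V)) (v x)]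
    simp
  · intro x _
    exact ((continuous_apply_conjOp M f).comp
      (continuous_mul_const (v x))).integrable_of_hasCompactSupport
      (HasCompactSupport.of_compactSpace _)

/-- The weights are normalized fibre sizes of the product map, so summing over fibres gives a
uniform average over tuples. -/
theorem sum_productWeight_smul {d ℓ : ℕ} (G : Fin ℓ → Subgroup (U d)) [∀ j, Finite (G j)]
    [Fintype (∀ j, G j)] {Z : Type*} [AddCommMonoid Z] [Module ℂ Z] (F : U d → Z) :
    ∑ V ∈ productSet G, (productWeight G V : ℂ) • F V =
      (Fintype.card (∀ j, G j) : ℂ)⁻¹ • ∑ h : ∀ j, G j, F (tupleProd G h) := by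
  classical
  rw [← Finset.sum_fiberwise_of_maps_to (s := Finset.univ) (t := productSet G) (g := tupleProd G)
    (fun h _ => by simp [productSet]), Finset.smul_sum]
  refine Finset.sum_congr rfl fun V _ => ?_
  rw [Finset.sum_congr rfl (g := fun _ => F V) (fun h hh => by rw [(Finset.mem_filter.1 hh).2]),
    Finset.sum_const, ← Nat.cast_smul_eq_nsmul ℂ, smul_smul]
  congr 1
  rw [productWeight, ← Nat.card_eq_fintype_card, Nat.card_pi, Nat.card_eq_fintype_card,
    Fintype.card_subtype]
  push_cast
  rw [div_eq_mul_inv, mul_comm]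

theorem productWeight_mem_Icc {d ℓ : ℕ} (G : Fin ℓ → Subgroup (U d)) [∀ j, Finite (G j)]
    (V : U d) : productWeight G V ∈ Set.Icc (0 : ℝ) 1 := by
  refine ⟨by unfold productWeight; positivity, ?_⟩
  rw [productWeight, ← Nat.cast_prod, ← Nat.card_pi]
  refine div_le_one_of_le₀ ?_ (Nat.cast_nonneg _)
  exact_mod_cast Nat.card_le_card_of_injective _ Subtype.val_injective

end UnitaryDesign

end

theorem mainTheorem1 (d t ℓ : ℕ) (G : Fin ℓ → Subgroup (UnitaryDesign.U d))
    [∀ j, Finite (G j)]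
    (hirr : ∀ γ ∈ UnitaryDesign.diagrams t d,
      ∃ j, Representation.IsIrreducible (k := ℂ) (V := UnitaryDesign.weylSpace d γ)
        (UnitaryDesign.weylRepRes γ (G j)))
    (hint : ∀ γ ∈ UnitaryDesign.diagrams t d, ∀ η ∈ UnitaryDesign.diagrams t d, γ ≠ η →
      ∃ j, ∀ A : Representation.IntertwiningMap
        (UnitaryDesign.weylRepRes γ (G j)) (UnitaryDesign.weylRepRes η (G j)), A = 0) :
    UnitaryDesign.IsGeneralizedGroupDesign G t := by
  have (j : Fin ℓ) : Fintype (G j) := Fintype.ofFinite _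
  refine ⟨fun V _ => UnitaryDesign.productWeight_mem_Icc G V, fun M f => ?_⟩
  rw [UnitaryDesign.sum_productWeight_smul, map_smul, smul_eq_mul,
    ← UnitaryDesign.card_mul_integral_conjOp _ M
      (UnitaryDesign.sum_conjOp_tupleProd_comm hirr hint M) f,
    inv_mul_cancel_left₀ (Nat.cast_ne_zero.2 Fintype.card_ne_zero)]
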